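/- Work with two qubits, i.e. with $4\times4$ Hermitian matrices (observables) on $\mathbb C^2\otimes\mathbb C^2$, a real vector space of dimension $16$. A separable state is a finite convex combination of products $\rho_A\otimes\rho_B$ of positive semidefinite $2\times 2$ matrices of unit trace. The cone of potential witnesses is the set of observables $W$ with $\mathrm{Tr}(W\rho_s)\ge 0$ for all separable states $\rho_s$; its interior is taken in the space of observables. For $M=M_A\otimes M_B$ with $M_A,M_B\in SL(2,\mathbb C)$ put $\rho^M=M^\dagger\rho M$ for states and $W^M=M^{-1}W(M^{-1})^\dagger$ for observables. Let $P_\mu=|\beta_\mu\rangle\langle\beta_\mu|$, $\mu=0,1,2,3$, be the projections on the Bell states $$\beta_0=\tfrac{|00\rangle+|11\rangle}{\sqrt2},\quad \beta_1=\tfrac{|00\rangle-|11\rangle}{\sqrt2},\quad \beta_2=\tfrac{|01\rangle+|10\rangle}{\sqrt2},\quad \beta_3=\tfrac{|01\rangle-|10\rangle}{i\sqrt2}.$$ **Theorem.** Let $W$ and $\rho$ lie in the interior of the cone of potential witnesses. Then there is exactly one $(\rho_\mu)\in\mathbb R^4$ in canonical order $\rho_0\ge\rho_1\ge\rho_2\ge|\rho_3|$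 such that $\rho^N=\rho_e:=\sum_\mu\rho_\mu P_\mu$ for some $N=N_A\otimes N_B$ with $N_A,N_B\in SL(2,\mathbb C)$, and exactly one $(\omega_\mu)\in\mathbb R^4$ in anti-canonical order $\omega_0\le\omega_1\le\omega_2\le\omega_3$ such that $W^{N'}=W_e:=\sum_\mu\omega_\mu P_\mu$ for some $N'=N'_A\otimes N'_B$ with $N'_A,N'_B\in SL(2,\mathbb C)$. With these canonical forms, the minimum below is attained and $$\min_{M}\ \mathrm{Tr}(W^M\rho)=\mathrm{Tr}(W_e\rho_e)=\sum_\mu\rho_\mu\,\omega_\mu ,$$ where $M$ runs over all $M_A\otimes M_B$ with $M_A,M_B\in SL(2,\mathbb C)$. In particular (the case $\rho=\mathbb I$), bringing $W$ to canonical form does not increase the trace: whenever $W^N=\sum_\mu\omega_\mu P_\mu$ with real $\omega_\mu$ in any order, $\min_M\mathrm{Tr}(W^M)=\mathrm{Tr}\big(\sum_\mu\omega_\mu P_\mu\big)\le \mathrm{Tr}\,W$. -/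

import Mathlib

open scoped ComplexOrder Kronecker

namespace TwoQubit

/-- Operators on one qubit. -/
abbrev Op1 := Matrix (Fin 2) (Fin 2) ℂ

/-- Operators on two qubits, `ℂ² ⊗ ℂ²` having the basis `|a⟩ ⊗ |b⟩` indexed by `(a, b)`. -/
abbrev Op2 := Matrix (Fin 2 × Fin 2) (Fin 2 × Fin 2) ℂ

/-- Two-qubit observables: the 16-dimensional real space of Hermitian operators, with its usual
topology (the one induced from the entries). Interiors are taken in this space. -/
abbrev Observable := selfAdjoint Op2

/-- The product vector `|a⟩ ⊗ |b⟩` of the computational basis. -/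
def ket (a b : Fin 2) : Fin 2 × Fin 2 → ℂ := Pi.single (a, b) 1

/-- The Bell states `β₀ = (|00⟩ + |11⟩)/√2`, `β₁ = (|00⟩ - |11⟩)/√2`,
`β₂ = (|01⟩ + |10⟩)/√2`, `β₃ = (|01⟩ - |10⟩)/(i√2)`. -/
noncomputable def bellState : Fin 4 → (Fin 2 × Fin 2 → ℂ) :=
  ![((√2 : ℝ) : ℂ)⁻¹ • (ket 0 0 + ket 1 1),
    ((√2 : ℝ) : ℂ)⁻¹ • (ket 0 0 - ket 1 1),
    ((√2 : ℝ) : ℂ)⁻¹ • (ket 0 1 + ket 1 0),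
    (Complex.I * ((√2 : ℝ) : ℂ))⁻¹ • (ket 0 1 - ket 1 0)]

/-- The Bell projection `P_μ = |β_μ⟩⟨β_μ|`. -/
noncomputable def bellProj (μ : Fin 4) : Op2 :=
  Matrix.vecMulVec (bellState μ) (star (bellState μ))

theorem bellProj_isSelfAdjoint (μ : Fin 4) : IsSelfAdjoint (bellProj μ) := by
  rw [isSelfAdjoint_iff, Matrix.star_eq_conjTranspose, bellProj, Matrix.conjTranspose_vecMulVec,
    star_star]

/-- The operator `∑_μ ω_μ P_μ` with real coefficients. -/
noncomputable def bellDiag (ω : Fin 4 → ℝ) : Observable :=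
  ⟨∑ μ, ω μ • bellProj μ, by
    refine AddSubgroup.sum_mem _ fun μ _ => ?_
    exact (IsSelfAdjoint.all (ω μ)).smul (bellProj_isSelfAdjoint μ)⟩

/-- A (normalized) state is separable if it is a finite convex combination of product states. -/
def IsSeparable (ρ : Op2) : Prop :=
  ∃ (N : ℕ) (p : Fin N → ℝ) (ρA ρB : Fin N → Op1),
    (∀ n, 0 ≤ p n) ∧ ∑ n, p n = 1 ∧
    (∀ n, (ρA n).PosSemidef ∧ (ρA n).trace = 1) ∧
    (∀ n, (ρB n).PosSemidef ∧ (ρB n).trace = 1) ∧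
    ρ = ∑ n, p n • (ρA n ⊗ₖ ρB n)

theorem IsSeparable.isSelfAdjoint {ρ : Op2} (h : IsSeparable ρ) : IsSelfAdjoint ρ := by
  obtain ⟨N, p, ρA, ρB, -, -, hA, hB, rfl⟩ := h
  refine isSelfAdjoint_sum _ fun n _ => (IsSelfAdjoint.all (p n)).smul ?_
  rw [isSelfAdjoint_iff, Matrix.star_eq_conjTranspose, Matrix.conjTranspose_kronecker,
    (hA n).1.isHermitian.eq, (hB n).1.isHermitian.eq]

/-- The pairing `Tr(A B)` of two observables as a real number; the trace is real,
see `coe_trPair`. -/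
noncomputable def trPair (A B : Observable) : ℝ := ((A : Op2) * (B : Op2)).trace.re

theorem coe_trPair (A B : Observable) :
    (trPair A B : ℂ) = ((A : Op2) * (B : Op2)).trace := by
  refine Complex.conj_eq_iff_re.mp ?_
  have hA : (A : Op2).conjTranspose = A := A.2
  have hB : (B : Op2).conjTranspose = B := B.2
  rw [starRingEnd_apply, ← Matrix.trace_conjTranspose, Matrix.conjTranspose_mul, hA, hB,
    Matrix.trace_mul_comm]

/-- The trace of an observable as a real number; the trace is real, see `coe_tr`. -/
noncomputable def tr (A : Observable) : ℝ := (A : Op2).trace.re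

theorem coe_tr (A : Observable) : (tr A : ℂ) = (A : Op2).trace := by
  refine Complex.conj_eq_iff_re.mp ?_
  have hA : (A : Op2).conjTranspose = A := A.2
  rw [starRingEnd_apply, ← Matrix.trace_conjTranspose, hA]

/-- The cone of potential witnesses: the dual cone of the separable states. -/
def potentialWitnesses : Set Observable :=
  {W | ∀ ρ : Observable, IsSeparable (ρ : Op2) → 0 ≤ trPair W ρ}

/-- A pair `(M_A, M_B)` of elements of `SL(2, ℂ)`. -/
abbrev LSL := Matrix.SpecialLinearGroup (Fin 2) ℂ × Matrix.SpecialLinearGroup (Fin 2) ℂ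

/-- The local operation `M = M_A ⊗ M_B`. -/
def LSL.toOp (M : LSL) : Op2 := (M.1 : Op1) ⊗ₖ (M.2 : Op1)

theorem LSL.isUnit_toOp (M : LSL) : IsUnit M.toOp := by
  rw [Matrix.isUnit_iff_isUnit_det, LSL.toOp, Matrix.det_kronecker]
  simp

/-- States transform as `ρ ↦ ρ^M = M† ρ M`. -/
def stateAct (M : LSL) (ρ : Observable) : Observable :=
  ⟨star M.toOp * (ρ : Op2) * M.toOp, IsSelfAdjoint.conjugate' ρ.2 M.toOp⟩

/-- Observables transform contragradiently, `W ↦ W^M = M⁻¹ W (M⁻¹)†`. -/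
noncomputable def obsAct (M : LSL) (W : Observable) : Observable :=
  ⟨M.toOp⁻¹ * (W : Op2) * star M.toOp⁻¹, IsSelfAdjoint.conjugate W.2 M.toOp⁻¹⟩

/-- `∑_μ ω_μ P_μ` is a canonical form of the observable `W`. -/
def IsObsForm (W : Observable) (ω : Fin 4 → ℝ) : Prop :=
  ∃ M : LSL, obsAct M W = bellDiag ω

/-- `∑_μ r_μ P_μ` is a canonical form of the state `ρ`. -/
def IsStateForm (ρ : Observable) (r : Fin 4 → ℝ) : Prop :=
  ∃ M : LSL, stateAct M ρ = bellDiag r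

/-- The canonical order `ω₀ ≥ ω₁ ≥ ω₂ ≥ |ω₃|`. -/
def CanonicalOrder (ω : Fin 4 → ℝ) : Prop :=
  ω 0 ≥ ω 1 ∧ ω 1 ≥ ω 2 ∧ ω 2 ≥ |ω 3|

/-- The anti-canonical order `ω₀ ≤ ω₁ ≤ ω₂ ≤ ω₃`. -/
def AntiCanonicalOrder (ω : Fin 4 → ℝ) : Prop :=
  ω 0 ≤ ω 1 ∧ ω 1 ≤ ω 2 ∧ ω 2 ≤ ω 3

end TwoQubit

namespace TwoQubit

open Matrix Complex

/-! In the magic basis a local operation in `SL(2, ℂ) × SL(2, ℂ)` becomes a complex orthogonal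
matrix `S`, Bell-diagonal observables become real diagonal matrices, and product vectors become
isotropic vectors `x ⬝ᵥ x = 0`. The pairing of a transformed `W` with `∑ r_ν P_ν` is then `∑ r_ν
q(S_ν)`, where `q` is the Hermitian form of `W` evaluated on the rows of `S`.

Existence: if `W` is interior, `q` is bounded below by a positive multiple of the norm on isotropic
vectors. Since `x ± I y` is isotropic for orthonormal `x, y`, sums `q(S_i) + q(S_j)` are bounded
below too, so for distinct positive weights `r` the pairing is coercive and attains its minimum
(`exists_isMin_sum_rowForm`). Varying by plane rotations with real and imaginary angles kills the
off-diagonal entries of `W`, and a quarter turn orders the diagonal oppositely to `r`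
(`of_isMin_sum_rowForm`).

Minimum: for diagonal forms the claim is a rearrangement inequality for the numbers `|S_νμ|²`
(`sum_mul_le_of_orthogonal`). It is bilinear in `r` and `ω`, hence reduces to the generators of the
two order cones. The extra condition `ω 0 + ω 1 ≥ 0` comes from positivity on isotropic vectors
(`add_nonneg_of_isObsForm`).

Uniqueness: the minimum depends only on the orbits, so pairing with enough test forms determines the
ordered coefficients. -/

/-! ### The magic basis: local operations as complex orthogonal matrices -/

/-- The magic basis: the Bell states with phases making the `SL(2, ℂ)`-invariant bilinear form
the standard one. -/
noncomputable def magic : Matrix (Fin 2 × Fin 2) (Fin 4) ℂ :=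
  Matrix.of fun p μ => (![1, I, I, I] : Fin 4 → ℂ) μ * bellState μ p

theorem inv_sqrt_two_mul_self : (((√2 : ℝ) : ℂ)⁻¹) * (((√2 : ℝ) : ℂ)⁻¹) = 1 / 2 := by
  rw [← mul_inv, ← Complex.ofReal_mul, Real.mul_self_sqrt (by norm_num)]
  norm_num

/-- The magic basis up to normalization, in coordinates. -/
def magicAux : Matrix (Fin 2 × Fin 2) (Fin 4) ℂ :=
  Matrix.of fun p => (![![![1, I, 0, 0], ![0, 0, I, 1]], ![![0, 0, I, -1], ![1, -I, 0, 0]]] :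
    Fin 2 → Fin 2 → Fin 4 → ℂ) p.1 p.2

theorem magic_eq : magic = ((√2 : ℝ) : ℂ)⁻¹ • magicAux := by
  have h2 : ((√2 : ℝ) : ℂ) ≠ 0 := by
    simp
  ext ⟨a, b⟩ μ
  fin_cases μ <;> fin_cases a <;> fin_cases b <;>
    simp [magic, magicAux, bellState, ket, Pi.single_apply] <;> field_simp <;> simp

theorem magic_conjTranspose_mul_mul (X : Op2) :
    magicᴴ * X * magic = (1 / 2 : ℂ) • (magicAuxᴴ * X * magicAux) := by
  rw [magic_eq, conjTranspose_smul, Matrix.smul_mul, Matrix.smul_mul, Matrix.mul_smul, smul_smul,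
    ← inv_sqrt_two_mul_self]
  congr 2
  simp

theorem magic_unitary : magicᴴ * magic = 1 := by
  have h := magic_conjTranspose_mul_mul 1
  rw [Matrix.mul_one, Matrix.mul_one] at h
  rw [h]
  ext i j
  fin_cases i <;> fin_cases j <;>
    simp [magicAux, Matrix.mul_apply, Fintype.sum_prod_type] <;> norm_num

theorem magic_unitary' : magic * magicᴴ = 1 := by
  rw [magic_eq, conjTranspose_smul, Matrix.smul_mul, Matrix.mul_smul, smul_smul]
  have : ((√2 : ℝ) : ℂ)⁻¹ * star ((√2 : ℝ) : ℂ)⁻¹ = 1 / 2 := by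
    rw [← inv_sqrt_two_mul_self]; simp
  rw [this]
  ext ⟨a, b⟩ ⟨c, d⟩
  fin_cases a <;> fin_cases b <;> fin_cases c <;> fin_cases d <;>
    simp [magicAux, Matrix.mul_apply, Fin.sum_univ_four] <;> norm_num

/-- The matrix of an operator in the magic basis. -/
noncomputable def frame (X : Op2) : Matrix (Fin 4) (Fin 4) ℂ := magicᴴ * X * magic

theorem frame_mul (X Y : Op2) : frame (X * Y) = frame X * frame Y := by
  have : frame X * frame Y = magicᴴ * X * (magic * magicᴴ) * Y * magic := by
    simp only [frame, Matrix.mul_assoc]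
  rw [this, magic_unitary', Matrix.mul_one, frame]
  simp only [Matrix.mul_assoc]

theorem frame_one : frame 1 = 1 := by
  rw [frame, Matrix.mul_one, magic_unitary]

theorem frame_conjTranspose (X : Op2) : frame Xᴴ = (frame X)ᴴ := by
  simp only [frame, conjTranspose_mul, conjTranspose_conjTranspose, Matrix.mul_assoc]

theorem trace_frame (X : Op2) : (frame X).trace = X.trace := by
  rw [frame, trace_mul_comm, ← Matrix.mul_assoc, magic_unitary', Matrix.one_mul]

theorem frame_injective : Function.Injective frame := by
  intro X Y h
  have key : ∀ Z : Op2, magic * frame Z * magicᴴ = Z := by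
    intro Z
    have : magic * frame Z * magicᴴ = magic * magicᴴ * Z * (magic * magicᴴ) := by
      simp only [frame, Matrix.mul_assoc]
    rw [this, magic_unitary', Matrix.one_mul, Matrix.mul_one]
  rw [← key X, h, key Y]

theorem frame_bellDiag (ω : Fin 4 → ℝ) :
    frame (bellDiag ω : Op2) = diagonal fun μ => (ω μ : ℂ) := by
  have h : (bellDiag ω : Op2) = magic * (diagonal fun μ => (ω μ : ℂ)) * magicᴴ := by
    ext p q
    rw [Matrix.mul_apply]
    simp only [bellDiag, Matrix.sum_apply, Matrix.smul_apply, bellProj, vecMulVec_apply,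
      mul_diagonal, conjTranspose_apply, magic, of_apply, Pi.star_apply]
    refine Finset.sum_congr rfl fun μ _ => ?_
    fin_cases μ <;> simp <;> ring_nf <;> simp
  have : frame (bellDiag ω : Op2) =
      magicᴴ * magic * (diagonal fun μ => (ω μ : ℂ)) * (magicᴴ * magic) := by
    rw [h]; simp only [frame, Matrix.mul_assoc]
  rw [this, magic_unitary, Matrix.one_mul, Matrix.mul_one]

/-- A determinant-one matrix preserves the symplectic form `J`, so `A ⊗ B` preserves the symmetric
form `J ⊗ J`, which the magic basis turns into the standard one. -/
theorem frame_kronecker_orthogonal {A B : Op1} (hA : A.det = 1) (hB : B.det = 1) :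
    (frame (A ⊗ₖ B))ᵀ * frame (A ⊗ₖ B) = 1 := by
  rw [det_fin_two] at hA hB
  have h0 : (A ⊗ₖ B)ᵀ * (magicᴴᵀ * magicᴴ) * (A ⊗ₖ B) = magicᴴᵀ * magicᴴ := by
    have : magicᴴᵀ * magicᴴ = (1 / 2 : ℂ) • (magicAuxᴴᵀ * magicAuxᴴ) := by
      rw [magic_eq, conjTranspose_smul, transpose_smul, Matrix.smul_mul, Matrix.mul_smul, smul_smul,
        ← inv_sqrt_two_mul_self]
      simp
    rw [this, Matrix.mul_smul, Matrix.smul_mul]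
    congr 1
    have hG : magicAuxᴴᵀ * magicAuxᴴ =
        (2 : ℂ) • ((!![0, 1; -1, 0] : Op1) ⊗ₖ (!![0, 1; -1, 0] : Op1)) := by
      ext ⟨a, b⟩ ⟨c, d⟩
      fin_cases a <;> fin_cases b <;> fin_cases c <;> fin_cases d <;>
        simp [magicAux, Matrix.mul_apply, Fin.sum_univ_four] <;> norm_num
    rw [hG, Matrix.mul_smul, Matrix.smul_mul, ← kroneckerMap_transpose, ← mul_kronecker_mul,
      ← mul_kronecker_mul]
    have hJ : ∀ X : Op1, X 0 0 * X 1 1 - X 0 1 * X 1 0 = 1 →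
        Xᵀ * !![0, 1; -1, 0] * X = !![0, 1; -1, 0] := by
      intro X hX
      ext i j
      fin_cases i <;> fin_cases j <;> simp [Matrix.mul_apply, Fin.sum_univ_two] <;>
        first | ring1 | linear_combination hX | linear_combination -hX
    rw [hJ A hA, hJ B hB]
  have : (frame (A ⊗ₖ B))ᵀ * frame (A ⊗ₖ B) =
      magicᵀ * ((A ⊗ₖ B)ᵀ * (magicᴴᵀ * magicᴴ) * (A ⊗ₖ B)) * magic := by
    simp only [frame, transpose_mul, Matrix.mul_assoc]
  rw [this, h0]
  have : magicᵀ * (magicᴴᵀ * magicᴴ) * magic = (magicᴴ * magic)ᵀ * (magicᴴ * magic) := by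
    simp only [transpose_mul, Matrix.mul_assoc]
  rw [this, magic_unitary]; simp

/-! ### The two actions and their pairing -/

theorem toOp_mul (M N : LSL) : (M * N).toOp = M.toOp * N.toOp := by
  simp [LSL.toOp, mul_kronecker_mul]

theorem toOp_one : (1 : LSL).toOp = 1 := by
  simp [LSL.toOp]

theorem toOp_inv (M : LSL) : M.toOp⁻¹ = (M⁻¹).toOp := by
  refine Matrix.inv_eq_left_inv ?_
  rw [← toOp_mul, inv_mul_cancel, toOp_one]

theorem obsAct_obsAct (M N : LSL) (W : Observable) :
    obsAct M (obsAct N W) = obsAct (N * M) W := by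
  apply Subtype.ext
  simp only [obsAct, toOp_mul, Matrix.mul_inv_rev, star_mul, Matrix.mul_assoc]

theorem obsAct_one (W : Observable) : obsAct 1 W = W := by
  apply Subtype.ext
  simp [obsAct, toOp_one]

theorem trPair_obsAct_stateAct (M : LSL) (W ρ : Observable) :
    trPair (obsAct M W) (stateAct M ρ) = trPair W ρ := by
  have h1 : M.toOp * M.toOp⁻¹ = 1 := by rw [toOp_inv, ← toOp_mul, mul_inv_cancel, toOp_one]
  have h2 : star M.toOp⁻¹ * star M.toOp = 1 := by rw [← star_mul, h1, star_one]
  simp only [trPair, obsAct, stateAct]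
  have : M.toOp⁻¹ * (W : Op2) * star M.toOp⁻¹ * (star M.toOp * (ρ : Op2) * M.toOp) =
      M.toOp⁻¹ * ((W : Op2) * (star M.toOp⁻¹ * star M.toOp) * (ρ : Op2) * M.toOp) := by
    simp only [Matrix.mul_assoc]
  rw [this, h2, trace_mul_comm, Matrix.mul_one]
  rw [Matrix.mul_assoc, h1, Matrix.mul_one]

/-- The Hermitian adjoint of a local operation. -/
def adj (M : LSL) : LSL :=
  (⟨(M.1 : Op1)ᴴ, by rw [det_conjTranspose, M.1.2, star_one]⟩,
    ⟨(M.2 : Op1)ᴴ, by rw [det_conjTranspose, M.2.2, star_one]⟩)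

theorem toOp_adj (M : LSL) : (adj M).toOp = star M.toOp := by
  rw [star_eq_conjTranspose, LSL.toOp, LSL.toOp, conjTranspose_kronecker]
  rfl

theorem adj_adj (M : LSL) : adj (adj M) = M := by
  ext <;> simp [adj]

/-- States and observables have the same orbits, so one diagonalization result serves both. -/
theorem stateAct_eq_obsAct (M : LSL) (ρ : Observable) : stateAct M ρ = obsAct (adj M)⁻¹ ρ := by
  apply Subtype.ext
  simp only [stateAct, obsAct, toOp_inv, inv_inv, toOp_adj, star_star]

theorem isStateForm_iff {ρ : Observable} {r : Fin 4 → ℝ} : IsStateForm ρ r ↔ IsObsForm ρ r := by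
  constructor
  · rintro ⟨M, hM⟩
    exact ⟨(adj M)⁻¹, by rw [← stateAct_eq_obsAct, hM]⟩
  · rintro ⟨M, hM⟩
    exact ⟨adj M⁻¹, by rw [stateAct_eq_obsAct, adj_adj, inv_inv, hM]⟩

/-- The real quadratic form `∑ x_i w_ij \bar{x_j}`. -/
noncomputable def rowForm (w : Matrix (Fin 4) (Fin 4) ℂ) (x : Fin 4 → ℂ) : ℝ :=
  (x ⬝ᵥ (w *ᵥ star x)).re

theorem trPair_obsAct_bellDiag (M : LSL) (W : Observable) (r : Fin 4 → ℝ) :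
    trPair (obsAct M W) (bellDiag r) =
      ∑ ν, r ν * rowForm (frame (W : Op2)) (frame (M⁻¹).toOp ν) := by
  rw [trPair, ← trace_frame, frame_mul, frame_bellDiag]
  simp only [obsAct, toOp_inv, frame_mul, star_eq_conjTranspose, frame_conjTranspose]
  simp only [trace, mul_diagonal, diag_apply, re_sum, Complex.re_mul_ofReal]
  refine Finset.sum_congr rfl fun ν _ => ?_
  rw [mul_comm, rowForm, Matrix.mul_assoc]
  rfl

/-! ### Inequalities for complex orthogonal matrices -/

theorem normSq_add_I_mul (a b : ℂ) :
    normSq (a + I * b) + normSq (a - I * b) = 2 * (normSq a + normSq b) := by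
  simp only [normSq_apply, add_re, sub_re, add_im, sub_im, I_mul_re, I_mul_im]
  ring

/-- Solve `x ⬝ᵥ x = c` for `x k * x k` and apply the triangle inequality. -/
theorem normSq_sq_le_sum {x : Fin 4 → ℂ} {c : ℂ} (hx : x ⬝ᵥ x = c) (k : Fin 4) :
    2 * normSq (x k) ≤ ‖c‖ + ∑ j, normSq (x j) := by
  have h : x k * x k = c - ∑ j ∈ Finset.univ.erase k, x j * x j := by
    rw [← hx, dotProduct, ← Finset.add_sum_erase _ _ (Finset.mem_univ k), add_sub_cancel_right]
  have h1 : normSq (x k) = ‖x k * x k‖ := by rw [norm_mul, normSq_eq_norm_sq, sq]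
  have h2 : normSq (x k) ≤ ‖c‖ + ∑ j ∈ Finset.univ.erase k, normSq (x j) := by
    rw [h1, h]
    refine (norm_sub_le _ _).trans (add_le_add le_rfl ?_)
    refine (norm_sum_le _ _).trans (le_of_eq (Finset.sum_congr rfl fun j _ => ?_))
    rw [norm_mul, normSq_eq_norm_sq, sq]
  rw [← Finset.add_sum_erase _ _ (Finset.mem_univ k)]
  linarith

theorem one_le_sum_normSq {x : Fin 4 → ℂ} (hx : x ⬝ᵥ x = 1) : 1 ≤ ∑ j, normSq (x j) := by
  calc (1 : ℝ) = ‖x ⬝ᵥ x‖ := by rw [hx, norm_one]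
    _ ≤ ∑ j, ‖x j * x j‖ := norm_sum_le _ _
    _ = ∑ j, normSq (x j) := Finset.sum_congr rfl fun j _ => by
        rw [norm_mul, normSq_eq_norm_sq, sq]

theorem isotropic_add_I_smul {x y : Fin 4 → ℂ} (hx : x ⬝ᵥ x = 1) (hy : y ⬝ᵥ y = 1)
    (hxy : x ⬝ᵥ y = 0) : (x + I • y) ⬝ᵥ (x + I • y) = 0 := by
  have hyx : y ⬝ᵥ x = 0 := by rw [dotProduct_comm, hxy]
  simp [hx, hy, hxy, hyx]

theorem isotropic_sub_I_smul {x y : Fin 4 → ℂ} (hx : x ⬝ᵥ x = 1) (hy : y ⬝ᵥ y = 1)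
    (hxy : x ⬝ᵥ y = 0) : (x - I • y) ⬝ᵥ (x - I • y) = 0 := by
  have hyx : y ⬝ᵥ x = 0 := by rw [dotProduct_comm, hxy]
  simp [hx, hy, hxy, hyx]

/-- Apply the one-vector bound with `c = 0` to the isotropic vectors `x ± I y` and add; the
parallelogram law removes the cross terms. -/
theorem normSq_pair_le_sum {x y : Fin 4 → ℂ} (hx : x ⬝ᵥ x = 1) (hy : y ⬝ᵥ y = 1)
    (hxy : x ⬝ᵥ y = 0) (k : Fin 4) :
    2 * (normSq (x k) + normSq (y k)) ≤ ∑ j, (normSq (x j) + normSq (y j)) := by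
  have h1 := normSq_sq_le_sum (isotropic_add_I_smul hx hy hxy) k
  have h2 := normSq_sq_le_sum (isotropic_sub_I_smul hx hy hxy) k
  rw [norm_zero, zero_add] at h1 h2
  have h3 := add_le_add h1 h2
  rw [← Finset.sum_add_distrib, ← mul_add] at h3
  simp only [Pi.add_apply, Pi.sub_apply, Pi.smul_apply, smul_eq_mul, normSq_add_I_mul,
    ← Finset.mul_sum] at h3
  linarith

theorem two_mul_column_add_two_le {S : Matrix (Fin 4) (Fin 4) ℂ} (hS : Sᵀ * S = 1) (k : Fin 4) :
    2 * ∑ i, normSq (S i k) + 2 ≤ ∑ j, ∑ i, normSq (S i j) := by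
  have hS' : S * Sᵀ = 1 := mul_eq_one_comm.mp hS
  have hcol : ∀ j j', ∑ i, S i j * S i j' = if j = j' then 1 else 0 := fun j j' => by
    have := congrFun (congrFun hS j) j'
    rwa [Matrix.mul_apply, Matrix.one_apply] at this
  set p : Fin 4 → ℝ := fun i => (S i k).re with hp
  set P : ℝ := ∑ i, p i ^ 2 with hP
  -- Expand the real part `p` of column `k` in the complex orthonormal columns of `S`: then `∑ v j *
  -- v j = P` and `v k = P`. Cauchy–Schwarz bounds the imaginary part of each `v j` by that of
  -- column `j`, hence by its norm.
  set v : Fin 4 → ℂ := (fun i => (p i : ℂ)) ᵥ* S with hv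
  have hre : ∀ j, ∑ i, ((S i j).re ^ 2 - (S i j).im ^ 2) = 1 := fun j => by
    have := congrArg Complex.re (hcol j j)
    rw [if_pos rfl, re_sum, one_re] at this
    rw [← this]
    exact Finset.sum_congr rfl fun i _ => by rw [mul_re]; ring
  have him : ∑ i, p i * (S i k).im = 0 := by
    have := congrArg Complex.im (hcol k k)
    rw [if_pos rfl, im_sum, one_im] at this
    have h2 : ∑ i, (S i k * S i k).im = 2 * ∑ i, p i * (S i k).im := by
      rw [Finset.mul_sum]
      exact Finset.sum_congr rfl fun i _ => by rw [mul_im]; ring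
    linarith
  have hvj : ∀ j, v j = ((∑ i, p i * (S i j).re : ℝ) : ℂ) + (∑ i, p i * (S i j).im : ℝ) * I := by
    intro j
    simp only [hv, vecMul, dotProduct]
    apply Complex.ext <;> simp
  have hvk : v k = (P : ℂ) := by
    rw [hvj, him, hP]
    simp [hp, sq]
  have hvv : ∑ j, v j * v j = (P : ℂ) := by
    have h1 : ∑ j, v j * v j = v ⬝ᵥ v := rfl
    have h2 : v ⬝ᵥ v = (fun i => (p i : ℂ)) ⬝ᵥ ((S * Sᵀ) *ᵥ fun i => (p i : ℂ)) := by
      rw [← Matrix.mulVec_mulVec, dotProduct_mulVec, Matrix.mulVec_transpose]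
    rw [h1, h2, hS', Matrix.one_mulVec, hP]
    simp [dotProduct, sq]
  have hC : ∀ j, ∑ i, normSq (S i j) = 1 + 2 * ∑ i, (S i j).im ^ 2 := fun j => by
    rw [← hre j, Finset.mul_sum, ← Finset.sum_add_distrib]
    exact Finset.sum_congr rfl fun i _ => by rw [normSq_apply]; ring
  have hCk : ∑ i, normSq (S i k) = 2 * P - 1 := by
    have h1 := hre k
    have h2 := hC k
    rw [Finset.sum_sub_distrib] at h1
    linarith
  have hP1 : 0 < P := by
    have h1 := hCk
    have h2 : 1 ≤ ∑ i, normSq (S i k) :=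
      one_le_sum_normSq (x := fun i => S i k) (by simpa [dotProduct] using hcol k k)
    linarith
  have hj : ∀ j, P - 2 * (v j * v j).re ≤ P * ∑ i, normSq (S i j) := fun j => by
    have hcs := Finset.sum_mul_sq_le_sq_mul_sq Finset.univ p fun i => (S i j).im
    rw [← hP] at hcs
    rw [hC, hvj]
    simp only [mul_re, add_re, add_im, ofReal_re, ofReal_im, I_re, I_im, mul_im]
    nlinarith [sq_nonneg (∑ i, p i * (S i j).re)]
  have hsum := Finset.sum_le_sum (s := Finset.univ.erase k) fun j _ => hj j
  have e1 := Finset.add_sum_erase Finset.univ (fun j => P - 2 * (v j * v j).re) (Finset.mem_univ k)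
  have e2 := Finset.add_sum_erase Finset.univ (fun j => P * ∑ i, normSq (S i j))
    (Finset.mem_univ k)
  have e3 : ∑ j, (P - 2 * (v j * v j).re) = 4 * P - 2 * P := by
    have := congrArg Complex.re hvv
    rw [re_sum, ofReal_re] at this
    rw [Finset.sum_sub_distrib, ← Finset.mul_sum, this]
    simp
  rw [hvk, ← ofReal_mul, ofReal_re, e3] at e1
  rw [← Finset.mul_sum, ← Finset.mul_sum, hCk] at e2
  rw [← Finset.mul_sum] at hsum
  rw [hCk]
  have : P * (4 * P) ≤ P * ∑ j, ∑ i, normSq (S i j) := by nlinarith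
  have := le_of_mul_le_mul_left this hP1
  linarith

/-- The two signatures are twice the partial transposes of `P₀` and `P₃`. Partial transposition
preserves trace pairings and replaces `B` by its complex conjugate, so the sum is `4 |⟨β₀| A ⊗ conj
B |β₃⟩|²`. -/
theorem signed_sum_normSq_frame_nonneg (A B : Op1) :
    0 ≤ ∑ ν, ∑ μ, (![1, 1, 1, -1] : Fin 4 → ℝ) ν * (![-1, 1, 1, 1] : Fin 4 → ℝ) μ *
      normSq (frame (A ⊗ₖ B) ν μ) := by
  have : ∑ ν, ∑ μ, (![1, 1, 1, -1] : Fin 4 → ℝ) ν * (![-1, 1, 1, 1] : Fin 4 → ℝ) μ *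
      normSq (frame (A ⊗ₖ B) ν μ) =
      normSq (A 0 0 * star (B 0 1) + A 1 0 * star (B 1 1) - A 0 1 * star (B 0 0)
        - A 1 1 * star (B 1 0)) := by
    simp only [frame, magic_conjTranspose_mul_mul, Fin.sum_univ_four]
    simp [magicAux, Matrix.mul_apply, Fintype.sum_prod_type, normSq_apply]
    ring
  rw [this]
  exact normSq_nonneg _

theorem rowForm_diagonal (ω : Fin 4 → ℝ) (x : Fin 4 → ℂ) :
    rowForm (diagonal fun μ => (ω μ : ℂ)) x = ∑ μ, ω μ * normSq (x μ) := by
  rw [rowForm, dotProduct, re_sum]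
  refine Finset.sum_congr rfl fun μ _ => ?_
  rw [mulVec_diagonal]
  simp [normSq_apply]
  ring

theorem sum_mul_le_of_orthogonal {S : Matrix (Fin 4) (Fin 4) ℂ} (hS : Sᵀ * S = 1)
    (hsign : 0 ≤ ∑ ν, ∑ μ, (![1, 1, 1, -1] : Fin 4 → ℝ) ν * (![-1, 1, 1, 1] : Fin 4 → ℝ) μ *
      normSq (S ν μ))
    {r ω : Fin 4 → ℝ} (hr : CanonicalOrder r) (hω : AntiCanonicalOrder ω)
    (hω' : 0 ≤ ω 0 + ω 1) :
    ∑ μ, r μ * ω μ ≤ ∑ ν, r ν * ∑ μ, ω μ * normSq (S ν μ) := by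
  have hS' : S * Sᵀ = 1 := mul_eq_one_comm.mp hS
  have hrow : ∀ i j, S i ⬝ᵥ S j = if i = j then 1 else 0 := fun i j => by
    have := congrFun (congrFun hS' i) j
    rwa [Matrix.mul_apply, Matrix.one_apply] at this
  have hcol : ∀ i j, Sᵀ i ⬝ᵥ Sᵀ j = if i = j then 1 else 0 := fun i j => by
    have := congrFun (congrFun hS i) j
    rwa [Matrix.mul_apply, Matrix.one_apply] at this
  have R : ∀ i, S i ⬝ᵥ S i = 1 := fun i => by rw [hrow, if_pos rfl]
  have C : ∀ i, Sᵀ i ⬝ᵥ Sᵀ i = 1 := fun i => by rw [hcol, if_pos rfl]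
  have a0 := one_le_sum_normSq (R 0)
  have a1 := one_le_sum_normSq (R 1)
  have a2 := one_le_sum_normSq (R 2)
  have a3 := one_le_sum_normSq (R 3)
  have c2 := one_le_sum_normSq (C 2)
  have c3 := one_le_sum_normSq (C 3)
  have b0 := normSq_sq_le_sum (R 0) 0
  have b3 := normSq_sq_le_sum (C 3) 3
  have p0 := normSq_pair_le_sum (R 0) (R 1) (by rw [hrow, if_neg (by decide)]) 0
  have p3 := normSq_pair_le_sum (C 2) (C 3) (by rw [hcol, if_neg (by decide)]) 3
  have d0 := two_mul_column_add_two_le hS 0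
  have d3 := two_mul_column_add_two_le (S := Sᵀ) (by rwa [transpose_transpose]) 3
  obtain ⟨r01, r12, r23⟩ := hr
  obtain ⟨w01, w12, w23⟩ := hω
  have r2p : 0 ≤ r 2 + r 3 := by linarith [neg_abs_le (r 3)]
  have r2m : 0 ≤ r 2 - r 3 := by linarith [le_abs_self (r 3)]
  have n := fun i j => normSq_nonneg (S i j)
  simp only [Fin.sum_univ_four, transpose_apply, norm_one] at *
  simp only [cons_val] at hsign
  generalize hA : (fun i j => normSq (S i j)) = A
  have hA' : ∀ i j, normSq (S i j) = A i j := fun i j => by rw [← hA]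
  simp only [hA'] at *
  clear hA' hA hrow hcol R C hS hS'
  have u0 : 0 ≤ r 0 - r 1 := by linarith
  have u1 : 0 ≤ r 1 - r 2 := by linarith
  have v0 : 0 ≤ ω 1 - ω 0 := by linarith
  have v1 : 0 ≤ ω 2 - ω 1 := by linarith
  have v2 : 0 ≤ ω 3 - ω 2 := by linarith
  -- The cone of `r` is generated by `(1,0,0,0)`, `(1,1,0,0)`, `(1,1,1,±1)`, that of `ω` by
  -- `(0,0,0,1)`, `(0,0,1,1)`, `(±1,1,1,1)`. Each of the products `q1` to `q16` settles one pair of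
  -- generators, and summation by parts reassembles them.
  have t : ∀ {x y z : ℝ}, 0 ≤ x → 0 ≤ y → 0 ≤ z → 0 ≤ x * y * z := fun hx hy hz =>
    mul_nonneg (mul_nonneg hx hy) hz
  have q1 := t u0 v2 (n 0 3)
  have q2 := t u0 v1 (add_nonneg (n 0 2) (n 0 3))
  have q3 := t u0 hω' (sub_nonneg.2 a0)
  have q4 := t u0 v0 (sub_nonneg.2 b0)
  have q5 := t u1 v2 (add_nonneg (n 0 3) (n 1 3))
  have q6 := t u1 v1 (add_nonneg (add_nonneg (n 0 2) (n 0 3)) (add_nonneg (n 1 2) (n 1 3)))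
  have q7 := t u1 hω' (add_nonneg (sub_nonneg.2 a0) (sub_nonneg.2 a1))
  have q8 := t u1 v0 (sub_nonneg.2 p0)
  have q9 := t r2p v2 (sub_nonneg.2 c3)
  have q10 := t r2p v1 (add_nonneg (sub_nonneg.2 c2) (sub_nonneg.2 c3))
  have q11 := t r2p hω' (add_nonneg (add_nonneg (sub_nonneg.2 a0) (sub_nonneg.2 a1))
    (add_nonneg (sub_nonneg.2 a2) (sub_nonneg.2 a3)))
  have q12 := t r2p v0 (sub_nonneg.2 d0)
  have q13 := t r2m v2 (sub_nonneg.2 b3)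
  have q14 := t r2m v1 (sub_nonneg.2 p3)
  have q15 := t r2m hω' (sub_nonneg.2 d3)
  have q16 := t r2m v0 hsign
  linear_combination q1 + q2 + q3 / 2 + q4 / 2 + q5 + q6 + q7 / 2 + q8 / 2 + q9 / 2 + q10 / 2
    + q11 / 4 + q12 / 4 + q13 / 2 + q14 / 2 + q15 / 4 + q16 / 4

/-- No order is needed for the trace: at most one `ω k` is negative, the others are at least `-ω k`,
and the column inequality makes the excess of the other columns outweigh that of column `k`. -/
theorem sum_le_of_orthogonal {S : Matrix (Fin 4) (Fin 4) ℂ} (hS : Sᵀ * S = 1)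
    {ω : Fin 4 → ℝ} (hω : ∀ i j, i ≠ j → 0 ≤ ω i + ω j) :
    ∑ μ, ω μ ≤ ∑ ν, ∑ μ, ω μ * normSq (S ν μ) := by
  have hC : ∀ k, 1 ≤ ∑ i, normSq (S i k) := fun k => by
    refine one_le_sum_normSq (x := Sᵀ k) ?_
    have := congrFun (congrFun hS k) k
    rwa [Matrix.mul_apply, Matrix.one_apply, if_pos rfl] at this
  have hD := two_mul_column_add_two_le hS
  rw [Finset.sum_comm]
  simp only [← Finset.mul_sum]
  set c : Fin 4 → ℝ := fun k => ∑ i, normSq (S i k) with hc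
  change ∀ k, 1 ≤ c k at hC
  change ∀ k, 2 * c k + 2 ≤ ∑ j, c j at hD
  change ∑ μ, ω μ ≤ ∑ μ, ω μ * c μ
  by_cases h : ∀ μ, 0 ≤ ω μ
  · exact Finset.sum_le_sum fun μ _ => le_mul_of_one_le_right (h μ) (hC μ)
  · push Not at h
    obtain ⟨k, hk⟩ := h
    have h1 : ∑ μ ∈ Finset.univ.erase k, -ω k * (c μ - 1) ≤
        ∑ μ ∈ Finset.univ.erase k, ω μ * (c μ - 1) := by
      refine Finset.sum_le_sum fun μ hμ => mul_le_mul_of_nonneg_right ?_ (sub_nonneg.2 (hC μ))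
      have := hω μ k (Finset.ne_of_mem_erase hμ)
      linarith
    have e1 := Finset.add_sum_erase Finset.univ (fun μ => ω μ * (c μ - 1)) (Finset.mem_univ k)
    have e2 := Finset.add_sum_erase Finset.univ (fun μ => c μ - 1) (Finset.mem_univ k)
    have e3 : ∑ μ, ω μ * (c μ - 1) = ∑ μ, ω μ * c μ - ∑ μ, ω μ := by
      simp only [mul_sub, mul_one, Finset.sum_sub_distrib]
    have e4 : ∑ μ, (c μ - 1) = ∑ μ, c μ - 4 := by
      simp [Finset.sum_sub_distrib]
    rw [← Finset.mul_sum] at h1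
    have := mul_nonneg (neg_nonneg.2 hk.le) (sub_nonneg.2 (hD k))
    rw [e4] at e2
    have e5 : ∑ x ∈ Finset.univ.erase k, (c x - 1) = ∑ μ, c μ - 4 - (c k - 1) := by linarith
    rw [e5] at h1
    nlinarith

/-! ### Plane rotations as local operations -/

/-- The planar complex rotation by `(c, s)` in the plane of `i` and `j`. -/
def planeRotation (i j : Fin 4) (c s : ℂ) : Matrix (Fin 4) (Fin 4) ℂ :=
  Matrix.of fun a b => if a = i then (if b = i then c else if b = j then s else 0)
    else if a = j then (if b = i then -s else if b = j then c else 0)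
    else if a = b then 1 else 0

theorem exists_half_angle {c s : ℂ} (h : c ^ 2 + s ^ 2 = 1) :
    ∃ p q : ℂ, p ^ 2 + q ^ 2 = 1 ∧ p ^ 2 - q ^ 2 = c ∧ 2 * p * q = s := by
  obtain ⟨p, hp⟩ := IsAlgClosed.exists_pow_nat_eq ((1 + c) / 2) (n := 2) (by norm_num)
  by_cases hp0 : p = 0
  -- When `p = 0`, `q` cannot be found by dividing by `2 * p`; here the rotation is the half turn.
  · subst hp0
    have hc : c = -1 := by linear_combination -2 * hp
    subst hc
    have hs : s = 0 := by
      have : s ^ 2 = 0 := by linear_combination h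
      exact pow_eq_zero_iff (by norm_num) |>.1 this
    exact ⟨0, 1, by norm_num, by norm_num, by rw [hs]; ring⟩
  · obtain ⟨q, hq⟩ : ∃ q : ℂ, 2 * p * q = s := ⟨s / (2 * p), by field_simp⟩
    have hq2 : q ^ 2 = (1 - c) / 2 := by
      have h1 : p ^ 2 * (4 * (q ^ 2 - (1 - c) / 2)) = 0 := by
        have : s ^ 2 = 4 * p ^ 2 * q ^ 2 := by rw [← hq]; ring
        linear_combination h - this - 2 * (1 - c) * hp
      have h2 := (mul_eq_zero.1 h1).resolve_left (pow_ne_zero 2 hp0)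
      linear_combination h2 / 4
    exact ⟨p, q, by rw [hp, hq2]; ring, by rw [hp, hq2]; ring, hq⟩

/-- The images of the quaternion units `i, j, k` in the magic basis. -/
def unitMatrix : Fin 3 → Op1 := ![!![I, 0; 0, -I], !![0, I; I, 0], !![0, 1; -1, 0]]

theorem det_add_smul_unitMatrix {p q : ℂ} (h : p ^ 2 + q ^ 2 = 1) (a : Fin 3) :
    (p • (1 : Op1) + q • unitMatrix a).det = 1 := by
  rw [← h, det_fin_two]
  fin_cases a <;> simp [unitMatrix] <;> ring_nf <;> simp

/-- The local operation `(p + q K) ⊗ (p + q' K)ᵀ` for a quaternion unit `K`. -/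
def unitOp (p q q' : ℂ) (h : p ^ 2 + q ^ 2 = 1) (h' : p ^ 2 + q' ^ 2 = 1) (a : Fin 3) : LSL :=
  (⟨p • 1 + q • unitMatrix a, det_add_smul_unitMatrix h a⟩,
    ⟨(p • 1 + q' • unitMatrix a)ᵀ, by rw [det_transpose, det_add_smul_unitMatrix h' a]⟩)

set_option maxHeartbeats 2000000 in
theorem exists_frame_eq_planeRotation {i j : Fin 4} (hij : i < j) {c s : ℂ}
    (h : c ^ 2 + s ^ 2 = 1) : ∃ M : LSL, frame M.toOp = planeRotation i j c s := by
  obtain ⟨p, q, h1, hc, hs⟩ := exists_half_angle h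
  have h1' : p ^ 2 + (-q) ^ 2 = 1 := by rw [neg_sq, h1]
  have key : ∃ (a : Fin 3) (q₁ q₂ : ℂ) (hq₁ : p ^ 2 + q₁ ^ 2 = 1) (hq₂ : p ^ 2 + q₂ ^ 2 = 1),
      frame (unitOp p q₁ q₂ hq₁ hq₂ a).toOp = planeRotation i j c s := by
    -- On coefficient matrices the operation is `Z ↦ (p + q₁ K) Z (p + q₂ K)`. Equal signs rotate
    -- the plane of `1` and `K`, the half angles adding up, and fix its complement; opposite signs
    -- give a conjugation, which rotates the complementary plane.
    fin_cases i <;> fin_cases j <;> first | (exfalso; revert hij; decide) | skip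
    on_goal 1 => refine ⟨0, -q, -q, h1', h1', ?_⟩
    on_goal 2 => refine ⟨1, -q, -q, h1', h1', ?_⟩
    on_goal 3 => refine ⟨2, -q, -q, h1', h1', ?_⟩
    on_goal 4 => refine ⟨2, q, -q, h1, h1', ?_⟩
    on_goal 5 => refine ⟨1, -q, q, h1', h1, ?_⟩
    on_goal 6 => refine ⟨0, q, -q, h1, h1', ?_⟩
    all_goals
      rw [frame, magic_conjTranspose_mul_mul]
      have h3 : q ^ 2 = 1 - p ^ 2 := by linear_combination h1
      ext a b
      rw [← hc, ← hs]
      fin_cases a <;> fin_cases b <;>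
        simp [magicAux, Matrix.mul_apply, Fintype.sum_prod_type, planeRotation, unitOp,
          unitMatrix, LSL.toOp] <;> ring_nf <;> simp [h3] <;> ring_nf
  obtain ⟨a, q₁, q₂, hq₁, hq₂, hM⟩ := key
  exact ⟨_, hM⟩

/-! ### First-order conditions at a minimum -/

/-- A nonzero linear term would dominate near `t = 0` and change sign. In the applications `u` is
the cosine or hyperbolic cosine when `t` is the corresponding sine. -/
theorem eq_zero_of_forall_small {α β : ℝ}
    (h : ∀ t : ℝ, |t| ≤ 1 / 2 → ∃ u, 1 / 2 ≤ u ∧ 0 ≤ α * t ^ 2 + β * t * u) : β = 0 := by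
  by_contra hβ
  have hb : 0 < |β| := abs_pos.2 hβ
  have hD : 0 < 4 * |α| + 2 * |β| := by positivity
  -- The denominator gives `|t| ≤ 1 / 2` and makes the linear term at `-t` outweigh `α * t ^ 2` even
  -- for `u = 1 / 2`.
  set t : ℝ := β / (4 * |α| + 2 * |β|) with ht
  have hβt : β = t * (4 * |α| + 2 * |β|) := by rw [ht]; field_simp
  have habs : |β| = |t| * (4 * |α| + 2 * |β|) := by
    conv_lhs => rw [hβt, abs_mul, abs_of_pos hD]
  have ht0 : 0 < |t| := by
    by_contra h0
    have := le_antisymm (not_lt.1 h0) (abs_nonneg t)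
    rw [this, zero_mul] at habs
    linarith
  have ht1 : |-t| ≤ 1 / 2 := by
    rw [abs_neg]
    nlinarith [abs_nonneg α]
  obtain ⟨u, hu, h0⟩ := h (-t) ht1
  have h1 : β * -t * u = -(t ^ 2 * (4 * |α| + 2 * |β|) * u) := by
    calc β * -t * u = (t * (4 * |α| + 2 * |β|)) * -t * u := by rw [← hβt]
      _ = _ := by ring
  rw [h1, neg_sq] at h0
  have ht2 : 0 < t ^ 2 := by rw [← sq_abs]; positivity
  have h2 : 0 ≤ t ^ 2 * (α - (4 * |α| + 2 * |β|) * u) := by linarith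
  have h3 := nonneg_of_mul_nonneg_right h2 ht2
  nlinarith [le_abs_self α, abs_nonneg α]

theorem rowForm_single_add {w : Matrix (Fin 4) (Fin 4) ℂ} (hw : w.IsHermitian)
    {i j : Fin 4} (a b : ℂ) :
    rowForm w (Pi.single i a + Pi.single j b) =
      normSq a * (w i i).re + normSq b * (w j j).re + 2 * (a * star b * w i j).re := by
  have hji : w j i = star (w i j) := (hw.apply j i).symm
  simp only [rowForm, star_add, Pi.star_single, mulVec_add, mulVec_single, add_dotProduct,
    dotProduct_add, single_dotProduct, Pi.smul_apply, col_apply, MulOpposite.smul_eq_mul_unop,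
    MulOpposite.unop_op, hji]
  simp [normSq_apply]
  ring

theorem planeRotation_row_left {i j : Fin 4} (c s : ℂ) (hij : i ≠ j) :
    planeRotation i j c s i = Pi.single i c + Pi.single j s := by
  ext b
  simp only [planeRotation, of_apply, if_true, Pi.add_apply, Pi.single_apply]
  split_ifs <;> simp_all

theorem planeRotation_row_right {i j : Fin 4} (c s : ℂ) (hij : i ≠ j) :
    planeRotation i j c s j = Pi.single i (-s) + Pi.single j c := by
  ext b
  simp only [planeRotation, of_apply, if_true, Pi.add_apply, Pi.single_apply, if_neg hij.symm]
  split_ifs <;> simp_all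

theorem planeRotation_row_of_ne {i j k : Fin 4} (c s : ℂ) (hi : k ≠ i) (hj : k ≠ j) :
    planeRotation i j c s k = (1 : Matrix (Fin 4) (Fin 4) ℂ) k := by
  ext b
  simp [planeRotation, hi, hj, Matrix.one_apply]

theorem sum_rowForm_planeRotation {w : Matrix (Fin 4) (Fin 4) ℂ} (hw : w.IsHermitian)
    {i j : Fin 4} (hij : i ≠ j) (c s : ℂ) (r : Fin 4 → ℝ) :
    ∑ ν, r ν * rowForm w (planeRotation i j c s ν) =
      ∑ ν, r ν * rowForm w ((1 : Matrix (Fin 4) (Fin 4) ℂ) ν) +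
      ((r i * (normSq c - 1) + r j * normSq s) * (w i i).re +
        (r i * normSq s + r j * (normSq c - 1)) * (w j j).re +
        2 * r i * (c * star s * w i j).re - 2 * r j * (s * star c * w i j).re) := by
  have hone : ∀ k, (1 : Matrix (Fin 4) (Fin 4) ℂ) k = Pi.single k 1 + Pi.single k 0 := fun k => by
    ext b; simp [Matrix.one_apply, Pi.single_apply, eq_comm]
  rw [← sub_eq_iff_eq_add', ← Finset.sum_sub_distrib, Fintype.sum_eq_add i j hij]
  · rw [planeRotation_row_left c s hij, planeRotation_row_right c s hij, hone, hone]
    simp only [rowForm_single_add hw]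
    simp
    ring
  · rintro k ⟨hi, hj⟩
    rw [planeRotation_row_of_ne c s hi hj, sub_self]

/-- Stationarity and the order of the diagonal at a minimum over local operations. -/
theorem of_isMin_sum_rowForm {w : Matrix (Fin 4) (Fin 4) ℂ} (hw : w.IsHermitian) {r : Fin 4 → ℝ}
    (hmin : ∀ M : LSL, ∑ ν, r ν * rowForm w ((1 : Matrix (Fin 4) (Fin 4) ℂ) ν) ≤
      ∑ ν, r ν * rowForm w (frame M.toOp ν))
    {i j : Fin 4} (hij : i < j) (hne : r i ≠ r j) (hadd : r i + r j ≠ 0) :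
    w i j = 0 ∧ 0 ≤ (r i - r j) * ((w j j).re - (w i i).re) := by
  have key : ∀ c s : ℂ, c ^ 2 + s ^ 2 = 1 →
      0 ≤ (r i * (normSq c - 1) + r j * normSq s) * (w i i).re +
        (r i * normSq s + r j * (normSq c - 1)) * (w j j).re +
        2 * r i * (c * star s * w i j).re - 2 * r j * (s * star c * w i j).re := fun c s h => by
    obtain ⟨M, hM⟩ := exists_frame_eq_planeRotation hij h
    have := hmin M
    rw [hM, sum_rowForm_planeRotation hw hij.ne] at this
    linarith
  have hreal : ∀ c s : ℝ, c ^ 2 + s ^ 2 = 1 →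
      0 ≤ (r i - r j) * ((w j j).re - (w i i).re) * s ^ 2 +
        2 * ((r i - r j) * (w i j).re) * s * c := fun c s h => by
    have := key c s (by exact_mod_cast congrArg ((↑) : ℝ → ℂ) h)
    simp only [normSq_ofReal, RCLike.star_def, conj_ofReal, ← ofReal_mul, re_ofReal_mul] at this
    have hc : c * c = 1 - s ^ 2 := by linarith
    rw [hc] at this
    linarith
  -- Rotations by an imaginary angle, with sine `s * I`, detect the imaginary part of `w i j`.
  have hhyp : ∀ c s : ℝ, c ^ 2 - s ^ 2 = 1 →
      0 ≤ (r i + r j) * ((w i i).re + (w j j).re) * s ^ 2 +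
        2 * ((r i + r j) * (w i j).im) * s * c := fun c s h => by
    have := key c (s * I) (by
      rw [mul_pow, I_sq, mul_neg_one, ← sub_eq_add_neg]
      exact_mod_cast congrArg ((↑) : ℝ → ℂ) h)
    have hc : c * c = 1 + s ^ 2 := by linarith
    simp [normSq_ofReal, hc] at this
    linarith
  have h1 : 2 * ((r i - r j) * (w i j).re) = 0 := by
    refine eq_zero_of_forall_small (α := (r i - r j) * ((w j j).re - (w i i).re)) fun t ht => ?_
    have ht2 : t ^ 2 ≤ 1 / 4 := by rw [← sq_abs]; nlinarith [abs_nonneg t]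
    refine ⟨√(1 - t ^ 2), Real.le_sqrt_of_sq_le (by linarith), hreal _ _ ?_⟩
    rw [Real.sq_sqrt (by linarith)]
    ring
  have h2 : 2 * ((r i + r j) * (w i j).im) = 0 := by
    refine eq_zero_of_forall_small (α := (r i + r j) * ((w i i).re + (w j j).re)) fun t _ => ?_
    have ht2 := sq_nonneg t
    refine ⟨√(1 + t ^ 2), Real.le_sqrt_of_sq_le (by linarith), hhyp _ _ ?_⟩
    rw [Real.sq_sqrt (by linarith)]
    ring
  refine ⟨Complex.ext ?_ ?_, ?_⟩
  · simpa [sub_ne_zero.2 hne] using h1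
  · simpa [hadd] using h2
  -- The quarter turn exchanges the two diagonal entries.
  · simpa using hreal 0 1 (by norm_num)

/-! ### Witnesses and isotropic vectors -/

theorem re_trace_mul_kronecker_nonneg {W : Observable} (hW : W ∈ potentialWitnesses) {A B : Op1}
    (hA : A.PosSemidef) (hB : B.PosSemidef) : 0 ≤ ((W : Op2) * (A ⊗ₖ B)).trace.re := by
  by_cases hA0 : A.trace = 0
  · simp [hA.trace_eq_zero_iff.1 hA0]
  by_cases hB0 : B.trace = 0
  · simp [hB.trace_eq_zero_iff.1 hB0]
  have hAt := hA.trace_nonneg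
  have hBt := hB.trace_nonneg
  have hsep : IsSeparable ((A.trace⁻¹ • A) ⊗ₖ (B.trace⁻¹ • B)) := by
    refine ⟨1, fun _ => 1, fun _ => A.trace⁻¹ • A, fun _ => B.trace⁻¹ • B, by simp, by simp,
      fun _ => ⟨hA.smul (inv_nonneg.2 hAt), ?_⟩, fun _ => ⟨hB.smul (inv_nonneg.2 hBt), ?_⟩,
      by simp⟩
    · rw [trace_smul, smul_eq_mul, inv_mul_cancel₀ hA0]
    · rw [trace_smul, smul_eq_mul, inv_mul_cancel₀ hB0]
  have h := hW ⟨_, hsep.isSelfAdjoint⟩ hsep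
  have e : ((W : Op2) * (A ⊗ₖ B)).trace = (A.trace * B.trace) *
      (trPair W ⟨_, hsep.isSelfAdjoint⟩ : ℝ) := by
    rw [coe_trPair]
    simp only [smul_kronecker, kronecker_smul, Matrix.mul_smul, trace_smul, smul_eq_mul]
    field_simp
  have h' : (0 : ℂ) ≤ ((W : Op2) * (A ⊗ₖ B)).trace := by
    rw [e]
    exact mul_nonneg (mul_nonneg hAt hBt) (by exact_mod_cast h)
  exact (Complex.nonneg_iff.1 h').1

theorem exists_eq_mul_of_det_eq_zero {z : Fin 2 × Fin 2 → ℂ}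
    (hz : z (0, 0) * z (1, 1) = z (0, 1) * z (1, 0)) :
    ∃ a b : Fin 2 → ℂ, ∀ p, z p = a p.1 * b p.2 := by
  by_cases h0 : z (0, 0) = 0
  · rw [h0, zero_mul, eq_comm, mul_eq_zero] at hz
    rcases hz with h1 | h1
    · refine ⟨![0, 1], ![z (1, 0), z (1, 1)], ?_⟩
      rintro ⟨i, j⟩
      fin_cases i <;> fin_cases j <;> simp [h0, h1]
    · refine ⟨![z (0, 1), z (1, 1)], ![0, 1], ?_⟩
      rintro ⟨i, j⟩
      fin_cases i <;> fin_cases j <;> simp [h0, h1]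
  · refine ⟨![1, z (1, 0) / z (0, 0)], ![z (0, 0), z (0, 1)], ?_⟩
    rintro ⟨i, j⟩
    fin_cases i <;> fin_cases j <;> simp [h0]
    field_simp
    linear_combination hz

theorem rowForm_frame (X : Op2) (x : Fin 4 → ℂ) :
    rowForm (frame X) x =
      (X * vecMulVec (magic *ᵥ star x) (star (magic *ᵥ star x))).trace.re := by
  rw [mul_vecMulVec, trace_vecMulVec, dotProduct_comm, star_mulVec, star_star, rowForm, frame,
    ← dotProduct_mulVec, mulVec_mulVec, mulVec_mulVec]

/-- The determinant of the coefficient matrix of `magic *ᵥ y` is half of `y ⬝ᵥ y`, so isotropic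
vectors are product vectors, on which a witness is nonnegative. -/
theorem rowForm_frame_nonneg {W : Observable} (hW : W ∈ potentialWitnesses) {x : Fin 4 → ℂ}
    (hx : x ⬝ᵥ x = 0) : 0 ≤ rowForm (frame (W : Op2)) x := by
  rw [rowForm_frame]
  obtain ⟨a, b, hab⟩ := exists_eq_mul_of_det_eq_zero (z := magic *ᵥ star x) (by
    have hx' : star x ⬝ᵥ star x = 0 := by rw [star_dotProduct_star, hx, star_zero]
    generalize star x = y at hx'
    simp only [dotProduct, Fin.sum_univ_four] at hx'
    rw [magic_eq]
    simp only [smul_mulVec, Pi.smul_apply, smul_eq_mul]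
    simp [magicAux, mulVec, dotProduct, Fin.sum_univ_four]
    linear_combination (↑√2)⁻¹ ^ 2 * (hx' - (y 1 ^ 2 + y 2 ^ 2) * I_sq))
  have h : vecMulVec (magic *ᵥ star x) (star (magic *ᵥ star x)) =
      vecMulVec a (star a) ⊗ₖ vecMulVec b (star b) := by
    ext p q
    simp only [vecMulVec_apply, kroneckerMap_apply, Pi.star_apply, hab, star_mul']
    ring
  rw [h]
  exact re_trace_mul_kronecker_nonneg hW (posSemidef_vecMulVec_self_star a)
    (posSemidef_vecMulVec_self_star b)

theorem rowForm_one (x : Fin 4 → ℂ) : rowForm 1 x = ∑ j, normSq (x j) := by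
  have := rowForm_diagonal (fun _ => 1) x
  simpa using this

/-- Interior points of the cone of potential witnesses are uniformly positive on isotropic
vectors. -/
theorem exists_pos_le_rowForm {W : Observable} (hW : W ∈ interior potentialWitnesses) :
    ∃ ε : ℝ, 0 < ε ∧ ∀ x : Fin 4 → ℂ, x ⬝ᵥ x = 0 →
      ε * ∑ j, normSq (x j) ≤ rowForm (frame (W : Op2)) x := by
  -- An interior `W` stays in the cone after subtracting a small multiple of the identity, and that
  -- multiple is the margin.
  let f : ℝ → Observable := fun t => W - t • 1
  have hf : Continuous f := by
    refine Continuous.subtype_mk ?_ _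
    fun_prop
  have h0 : f 0 = W := by simp [f]
  have hnhds : ∀ᶠ t in nhds 0, f t ∈ potentialWitnesses := by
    have := hf.continuousAt.eventually_mem (x := 0) (s := potentialWitnesses) (by
      rw [h0]; exact mem_interior_iff_mem_nhds.1 hW)
    exact this
  obtain ⟨δ, hδ, hball⟩ := Metric.eventually_nhds_iff.1 hnhds
  refine ⟨δ / 2, by positivity, fun x hx => ?_⟩
  have hmem : f (δ / 2) ∈ potentialWitnesses := hball (by
    rw [Real.dist_eq, sub_zero, abs_of_pos (by positivity)]; linarith)
  have h1 := rowForm_frame_nonneg hmem hx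
  have h2 : frame ((f (δ / 2) : Observable) : Op2) = frame (W : Op2) - ((δ / 2 : ℝ) : ℂ) • 1 := by
    have : ((f (δ / 2) : Observable) : Op2) = (W : Op2) - ((δ / 2 : ℝ) : ℂ) • 1 := by
      ext
      simp [f]
    rw [this, ← frame_one]
    simp only [frame, Matrix.mul_sub, Matrix.sub_mul, Matrix.mul_smul, Matrix.smul_mul]
  rw [h2, rowForm, sub_mulVec, dotProduct_sub, smul_mulVec, dotProduct_smul, sub_re, smul_eq_mul,
    re_ofReal_mul] at h1
  rw [← rowForm_one]
  exact sub_nonneg.1 h1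

theorem rowForm_add_I_smul (w : Matrix (Fin 4) (Fin 4) ℂ) (x y : Fin 4 → ℂ) :
    rowForm w (x + I • y) + rowForm w (x - I • y) = 2 * (rowForm w x + rowForm w y) := by
  simp only [rowForm, star_add, star_sub, star_smul, mulVec_add, mulVec_sub, mulVec_smul,
    add_dotProduct, sub_dotProduct, dotProduct_add, dotProduct_sub, dotProduct_smul,
    smul_dotProduct]
  simp
  ring

/-- Neither vector is isotropic, but `x ± I y` are; the parallelogram law for both `w` and the norm
(the case `w = 1`) returns to `x` and `y`. -/
theorem le_rowForm_add {w : Matrix (Fin 4) (Fin 4) ℂ} {ε : ℝ}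
    (hw : ∀ x : Fin 4 → ℂ, x ⬝ᵥ x = 0 → ε * ∑ j, normSq (x j) ≤ rowForm w x)
    {x y : Fin 4 → ℂ} (hx : x ⬝ᵥ x = 1) (hy : y ⬝ᵥ y = 1) (hxy : x ⬝ᵥ y = 0) :
    ε * (∑ j, normSq (x j) + ∑ j, normSq (y j)) ≤ rowForm w x + rowForm w y := by
  have h1 := hw _ (isotropic_add_I_smul hx hy hxy)
  have h2 := hw _ (isotropic_sub_I_smul hx hy hxy)
  have h3 := rowForm_add_I_smul w x y
  have h4 := rowForm_add_I_smul 1 x y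
  simp only [rowForm_one] at h4
  have h5 := congrArg (ε * ·) h4
  simp only [mul_add] at h5 ⊢
  linarith

theorem frame_toOp_orthogonal (M : LSL) : (frame M.toOp)ᵀ * frame M.toOp = 1 :=
  frame_kronecker_orthogonal M.1.2 M.2.2

theorem row_dotProduct_row {S : Matrix (Fin 4) (Fin 4) ℂ} (hS : Sᵀ * S = 1) (i j : Fin 4) :
    S i ⬝ᵥ S j = if i = j then 1 else 0 := by
  have := congrFun (congrFun (mul_eq_one_comm.mp hS : S * Sᵀ = 1) i) j
  rwa [Matrix.mul_apply, Matrix.one_apply] at this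

theorem le_rowForm_row_add {w : Matrix (Fin 4) (Fin 4) ℂ} {ε : ℝ}
    (hw : ∀ x : Fin 4 → ℂ, x ⬝ᵥ x = 0 → ε * ∑ j, normSq (x j) ≤ rowForm w x)
    {S : Matrix (Fin 4) (Fin 4) ℂ} (hS : Sᵀ * S = 1) {i j : Fin 4} (hij : i ≠ j) :
    ε * (∑ k, normSq (S i k) + ∑ k, normSq (S j k)) ≤ rowForm w (S i) + rowForm w (S j) := by
  apply le_rowForm_add hw <;> rw [row_dotProduct_row hS]
  · rw [if_pos rfl]
  · rw [if_pos rfl]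
  · rw [if_neg hij]

theorem add_nonneg_of_isObsForm {W : Observable} (hW : W ∈ potentialWitnesses) {ω : Fin 4 → ℝ}
    (hω : IsObsForm W ω) {i j : Fin 4} (hij : i ≠ j) : 0 ≤ ω i + ω j := by
  obtain ⟨M, hM⟩ := hω
  -- The weight `Pi.single ν 1` extracts a single diagonal entry from the pairing.
  have hd : ∀ ν, ω ν = rowForm (frame (W : Op2)) (frame (M⁻¹).toOp ν) := fun ν => by
    have h1 := trPair_obsAct_bellDiag M W (Pi.single ν 1)
    have h2 := trPair_obsAct_bellDiag 1 (bellDiag ω) (Pi.single ν 1)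
    rw [obsAct_one, ← hM, h1, inv_one, toOp_one, frame_one, hM, frame_bellDiag] at h2
    simp only [rowForm_diagonal] at h2
    simpa [Pi.single_apply, Matrix.one_apply] using h2.symm
  rw [hd i, hd j]
  have := le_rowForm_row_add (ε := 0) (fun x hx => by
    rw [zero_mul]; exact rowForm_frame_nonneg hW hx) (frame_toOp_orthogonal M⁻¹) hij
  rwa [zero_mul] at this

/-! ### Coercivity and existence of a diagonal form -/

/-- The squared Hilbert-Schmidt norm. -/
def sqNorm {n : Type*} [Fintype n] (A : Matrix n n ℂ) : ℝ := ∑ i, ∑ j, normSq (A i j)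

theorem sqNorm_eq_trace {n : Type*} [Fintype n] (A : Matrix n n ℂ) :
    (sqNorm A : ℂ) = (Aᴴ * A).trace := by
  simp only [sqNorm, trace, Matrix.mul_apply, diag_apply, conjTranspose_apply, ofReal_sum]
  rw [Finset.sum_comm]
  simp only [normSq_eq_conj_mul_self, RCLike.star_def]

theorem sqNorm_frame_kronecker (A B : Op1) : sqNorm (frame (A ⊗ₖ B)) = sqNorm A * sqNorm B := by
  have h : (sqNorm (frame (A ⊗ₖ B)) : ℂ) = sqNorm A * sqNorm B := by
    rw [sqNorm_eq_trace, sqNorm_eq_trace, sqNorm_eq_trace, ← frame_conjTranspose, ← frame_mul,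
      trace_frame, conjTranspose_kronecker, ← mul_kronecker_mul, trace_kronecker]
  exact_mod_cast h

theorem two_le_sqNorm {A : Op1} (hA : A.det = 1) : 2 ≤ sqNorm A := by
  have h : (1 : ℝ) ≤ ‖A 0 0‖ * ‖A 1 1‖ + ‖A 0 1‖ * ‖A 1 0‖ := by
    rw [← norm_mul, ← norm_mul]
    calc (1 : ℝ) = ‖A 0 0 * A 1 1 - A 0 1 * A 1 0‖ := by rw [← det_fin_two, hA, norm_one]
      _ ≤ _ := norm_sub_le _ _
  simp only [sqNorm, Fin.sum_univ_two, normSq_eq_norm_sq]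
  nlinarith [sq_nonneg (‖A 0 0‖ - ‖A 1 1‖), sq_nonneg (‖A 0 1‖ - ‖A 1 0‖)]

theorem norm_apply_le_sqNorm_add_one {n : Type*} [Fintype n] (A : Matrix n n ℂ) (i j : n) :
    ‖A i j‖ ≤ sqNorm A + 1 := by
  have h1 : normSq (A i j) ≤ sqNorm A :=
    (Finset.single_le_sum (f := fun j => normSq (A i j)) (fun _ _ => normSq_nonneg _)
      (Finset.mem_univ j)).trans
      (Finset.single_le_sum (f := fun i => ∑ j, normSq (A i j))
        (fun _ _ => Finset.sum_nonneg fun _ _ => normSq_nonneg _) (Finset.mem_univ i))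
  rw [normSq_eq_norm_sq] at h1
  nlinarith [sq_nonneg (‖A i j‖ - 1 / 2)]

theorem mul_sqNorm_le_sum_rowForm {w : Matrix (Fin 4) (Fin 4) ℂ} {ε : ℝ} (hε : 0 < ε)
    (hw : ∀ x : Fin 4 → ℂ, x ⬝ᵥ x = 0 → ε * ∑ j, normSq (x j) ≤ rowForm w x)
    {S : Matrix (Fin 4) (Fin 4) ℂ} (hS : Sᵀ * S = 1) (σ : Equiv.Perm (Fin 4)) {r : Fin 4 → ℝ}
    (hr : ∀ k, r (σ k) = 4 - (k : ℕ)) : ε * sqNorm S ≤ ∑ ν, r ν * rowForm w (S ν) := by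
  have hp := fun {i j : Fin 4} (h : i ≠ j) => le_rowForm_row_add hw hS (σ.injective.ne h)
  -- Only pairs of rows are controlled, so the weights are split as `(4,3,2,1) = 3(1,1,0,0) +
  -- (1,0,1,0) + (0,0,1,1)`.
  have h01 := hp (i := 0) (j := 1) (by decide)
  have h02 := hp (i := 0) (j := 2) (by decide)
  have h23 := hp (i := 2) (j := 3) (by decide)
  rw [sqNorm, ← Equiv.sum_comp σ, ← Equiv.sum_comp σ fun ν => r ν * rowForm w (S ν)]
  have n : ∀ k, 0 ≤ ε * ∑ j, normSq (S (σ k) j) := fun k =>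
    mul_nonneg hε.le (Finset.sum_nonneg fun _ _ => normSq_nonneg _)
  have n0 := n 0
  have n1 := n 1
  have n2 := n 2
  rw [Fin.sum_univ_four fun i => ∑ j, normSq (S (σ i) j),
    Fin.sum_univ_four fun i => r (σ i) * rowForm w (S (σ i)), hr, hr, hr, hr]
  simp only [mul_add] at h01 h02 h23 ⊢
  norm_num
  linarith

theorem continuous_sum_rowForm (w : Matrix (Fin 4) (Fin 4) ℂ) (r : Fin 4 → ℝ) :
    Continuous fun p : Op1 × Op1 => ∑ ν, r ν * rowForm w (frame (p.1 ⊗ₖ p.2) ν) := by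
  have h1 : Continuous fun p : Op1 × Op1 => p.1 ⊗ₖ p.2 :=
    continuous_matrix fun i j => by
      simp only [kroneckerMap_apply]
      exact (continuous_fst.matrix_elem _ _).mul (continuous_snd.matrix_elem _ _)
  have h2 : Continuous fun p : Op1 × Op1 => frame (p.1 ⊗ₖ p.2) :=
    (continuous_const.matrix_mul h1).matrix_mul continuous_const
  refine continuous_finsetSum _ fun ν _ => continuous_const.mul (continuous_re.comp ?_)
  have h3 : Continuous fun p : Op1 × Op1 => frame (p.1 ⊗ₖ p.2) ν :=
    (continuous_apply ν).comp h2
  exact h3.dotProduct (continuous_const.matrix_mulVec h3.star)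

theorem exists_isMin_sum_rowForm {w : Matrix (Fin 4) (Fin 4) ℂ} {ε : ℝ} (hε : 0 < ε)
    (hw : ∀ x : Fin 4 → ℂ, x ⬝ᵥ x = 0 → ε * ∑ j, normSq (x j) ≤ rowForm w x)
    (σ : Equiv.Perm (Fin 4)) {r : Fin 4 → ℝ} (hr : ∀ k, r (σ k) = 4 - (k : ℕ)) :
    ∃ M : LSL, ∀ N : LSL, ∑ ν, r ν * rowForm w (frame M.toOp ν) ≤
      ∑ ν, r ν * rowForm w (frame N.toOp ν) := by
  let g : Op1 × Op1 → ℝ := fun p => ∑ ν, r ν * rowForm w (frame (p.1 ⊗ₖ p.2) ν)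
  have hg : Continuous g := continuous_sum_rowForm w r
  have hlow : ∀ {p : Op1 × Op1}, p.1.det = 1 → p.2.det = 1 →
      ε * (sqNorm p.1 * sqNorm p.2) ≤ g p := fun h1 h2 => by
    rw [← sqNorm_frame_kronecker]
    exact mul_sqNorm_le_sum_rowForm hε hw (frame_kronecker_orthogonal h1 h2) σ hr
  -- On the sublevel set of the identity the product of the squared norms is bounded; each factor is
  -- at least `2`, so the other is bounded separately.
  let R : ℝ := g 1 / (2 * ε) + 1
  have hbound : ∀ {p : Op1 × Op1}, p.1.det = 1 → p.2.det = 1 → g p ≤ g 1 →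
      ∀ i j, ‖p.1 i j‖ ≤ R ∧ ‖p.2 i j‖ ≤ R := fun {p} h1 h2 hp i j => by
    have l1 := two_le_sqNorm h1
    have l2 := two_le_sqNorm h2
    have l3 := (hlow h1 h2).trans hp
    have m1 : sqNorm p.1 ≤ g 1 / (2 * ε) := by
      rw [le_div_iff₀ (by positivity)]
      nlinarith [mul_nonneg hε.le (mul_nonneg (by linarith : 0 ≤ sqNorm p.1) (sub_nonneg.2 l2))]
    have m2 : sqNorm p.2 ≤ g 1 / (2 * ε) := by
      rw [le_div_iff₀ (by positivity)]
      nlinarith [mul_nonneg hε.le (mul_nonneg (by linarith : 0 ≤ sqNorm p.2) (sub_nonneg.2 l1))]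
    exact ⟨(norm_apply_le_sqNorm_add_one _ i j).trans (by simp only [R]; linarith),
      (norm_apply_le_sqNorm_add_one _ i j).trans (by simp only [R]; linarith)⟩
  let B : Set Op1 := Set.univ.pi fun _ => Set.univ.pi fun _ => Metric.closedBall (0 : ℂ) R
  have hB : IsCompact B :=
    isCompact_univ_pi fun _ => isCompact_univ_pi fun _ => isCompact_closedBall _ _
  have hmemB : ∀ A : Op1, A ∈ B ↔ ∀ i j, ‖A i j‖ ≤ R := fun A =>
    ⟨fun h i j => by simpa using h i trivial j trivial, fun h i _ j _ => by simpa using h i j⟩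
  let K : Set (Op1 × Op1) := B ×ˢ B ∩ {p | p.1.det = 1 ∧ p.2.det = 1}
  have hK : IsCompact K := by
    refine (hB.prod hB).inter_right ?_
    exact (isClosed_eq continuous_fst.matrix_det continuous_const).inter
      (isClosed_eq continuous_snd.matrix_det continuous_const)
  have hmemK : ∀ {p : Op1 × Op1}, p.1.det = 1 → p.2.det = 1 → g p ≤ g 1 → p ∈ K :=
    fun h1 h2 hp => ⟨⟨(hmemB _).2 fun i j => (hbound h1 h2 hp i j).1,
      (hmemB _).2 fun i j => (hbound h1 h2 hp i j).2⟩, h1, h2⟩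
  have h1K : (1 : Op1 × Op1) ∈ K := hmemK det_one det_one le_rfl
  obtain ⟨p, hpK, hp⟩ := hK.exists_isMinOn ⟨1, h1K⟩ hg.continuousOn
  refine ⟨(⟨p.1, hpK.2.1⟩, ⟨p.2, hpK.2.2⟩), fun N => ?_⟩
  change g p ≤ g ((N.1 : Op1), (N.2 : Op1))
  by_cases hN : g ((N.1 : Op1), (N.2 : Op1)) ≤ g 1
  · exact hp (hmemK N.1.2 N.2.2 hN)
  · exact (hp h1K).trans (not_le.1 hN).le

theorem isHermitian_frame (W : Observable) : (frame (W : Op2)).IsHermitian := by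
  have hW : (W : Op2)ᴴ = W := W.2
  rw [IsHermitian, ← frame_conjTranspose, hW]

/-- Every interior point of the cone of potential witnesses can be diagonalized in the Bell basis
by a local operation, with coefficients in any prescribed order. -/
theorem exists_isObsForm {W : Observable} (hW : W ∈ interior potentialWitnesses)
    (σ : Equiv.Perm (Fin 4)) :
    ∃ ω : Fin 4 → ℝ, IsObsForm W ω ∧ ∀ k l : Fin 4, k ≤ l → ω (σ k) ≤ ω (σ l) := by
  obtain ⟨ε, hε, hw⟩ := exists_pos_le_rowForm hW
  -- Distinct positive weights make every `r i - r j` and `r i + r j` nonzero, so stationarity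
  -- determines all off-diagonal entries; they decrease along `σ`, so the diagonal increases along
  -- it.
  let r : Fin 4 → ℝ := fun ν => 4 - ((σ.symm ν : Fin 4) : ℕ)
  have hr : ∀ k, r (σ k) = 4 - (k : ℕ) := fun k => by simp [r]
  obtain ⟨M, hM⟩ := exists_isMin_sum_rowForm hε hw σ hr
  -- Replacing `W` by `V` moves the minimizer to the identity; the inverse appears because the
  -- pairing involves the rows of `M⁻¹`.
  let V : Observable := obsAct M⁻¹ W
  have hV := isHermitian_frame V
  have hmin : ∀ N : LSL, ∑ ν, r ν * rowForm (frame (V : Op2)) ((1 : Matrix (Fin 4) (Fin 4) ℂ) ν) ≤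
      ∑ ν, r ν * rowForm (frame (V : Op2)) (frame N.toOp ν) := fun N => by
    have e1 := trPair_obsAct_bellDiag 1 V r
    have e2 := trPair_obsAct_bellDiag N⁻¹ V r
    rw [obsAct_obsAct, trPair_obsAct_bellDiag] at e1 e2
    rw [inv_one, toOp_one, frame_one] at e1
    rw [inv_inv] at e2
    rw [← e1, ← e2]
    simpa using hM _
  have hrpos : ∀ i, 0 < r i := fun i => by
    have h : ((σ.symm i : Fin 4) : ℕ) ≤ 3 := Nat.le_of_lt_succ (σ.symm i).2
    have : (((σ.symm i : Fin 4) : ℕ) : ℝ) ≤ 3 := by exact_mod_cast h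
    simp only [r]
    linarith
  have hrinj : ∀ {i j}, i ≠ j → r i ≠ r j := fun {i j} hij h => hij <| by
    simp only [r, sub_right_inj, Nat.cast_inj, Fin.val_inj] at h
    exact σ.symm.injective h
  have hstat := fun {i j : Fin 4} (hij : i < j) =>
    of_isMin_sum_rowForm hV hmin hij (hrinj hij.ne) (add_pos (hrpos i) (hrpos j)).ne'
  let ω : Fin 4 → ℝ := fun ν => (frame (V : Op2) ν ν).re
  have hdiag : frame (V : Op2) = diagonal fun ν => (ω ν : ℂ) := by
    ext i j
    rcases lt_trichotomy i j with h | h | h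
    · rw [(hstat h).1, diagonal_apply_ne _ h.ne]
    · subst h
      rw [diagonal_apply_eq]
      exact (hV.coe_re_apply_self i).symm
    · rw [← hV.apply, (hstat h).1, star_zero, diagonal_apply_ne _ h.ne']
  refine ⟨ω, ⟨M⁻¹, Subtype.ext (frame_injective ?_)⟩, fun k l hkl => ?_⟩
  · rw [frame_bellDiag, ← hdiag]
  · rcases hkl.eq_or_lt with rfl | hlt
    · exact le_rfl
    have hlt' : r (σ l) < r (σ k) := by
      rw [hr, hr]
      have : ((k : ℕ) : ℝ) < (l : ℕ) := by exact_mod_cast hlt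
      linarith
    have key : 0 ≤ (r (σ k) - r (σ l)) * (ω (σ l) - ω (σ k)) := by
      rcases (σ.injective.ne hlt.ne).lt_or_gt with h | h
      · exact (hstat h).2
      · have := (hstat h).2
        simp only [ω]
        linarith
    exact sub_nonneg.1 (nonneg_of_mul_nonneg_right key (sub_pos.2 hlt'))

/-! ### The minimum and uniqueness of canonical forms -/

theorem trPair_obsAct_bellDiag_bellDiag (M : LSL) (ω r : Fin 4 → ℝ) :
    trPair (obsAct M (bellDiag ω)) (bellDiag r) =
      ∑ ν, r ν * ∑ μ, ω μ * normSq (frame (M⁻¹).toOp ν μ) := by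
  simp only [trPair_obsAct_bellDiag, frame_bellDiag, rowForm_diagonal]

theorem trPair_bellDiag (ω r : Fin 4 → ℝ) :
    trPair (bellDiag ω) (bellDiag r) = ∑ μ, r μ * ω μ := by
  have := trPair_obsAct_bellDiag_bellDiag 1 ω r
  rw [obsAct_one, inv_one, toOp_one, frame_one] at this
  rw [this]
  refine Finset.sum_congr rfl fun ν _ => ?_
  congr 1
  simp [Matrix.one_apply]

/-- Both operations are absorbed into the free one by the bijection `K ↦ N * K * M⁻¹` of the group.
-/
theorem range_trPair {W ρ : Observable} {M N : LSL} {ω r : Fin 4 → ℝ}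
    (hω : obsAct N W = bellDiag ω) (hr : stateAct M ρ = bellDiag r) :
    (Set.range fun K : LSL => trPair (obsAct K W) ρ) =
      Set.range fun K : LSL => trPair (obsAct K (bellDiag ω)) (bellDiag r) := by
  have key : ∀ K : LSL, trPair (obsAct K (bellDiag ω)) (bellDiag r) =
      trPair (obsAct (N * K * M⁻¹) W) ρ := fun K => by
    rw [← hr, ← hω, ← trPair_obsAct_stateAct M (obsAct (N * K * M⁻¹) W), obsAct_obsAct,
      obsAct_obsAct, inv_mul_cancel_right]
  ext x
  constructor
  · rintro ⟨K, rfl⟩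
    exact ⟨N⁻¹ * K * M, by simp only [key]; congr 2; group⟩
  · rintro ⟨K, rfl⟩
    exact ⟨N * K * M⁻¹, (key K).symm⟩

theorem isLeast_trPair {W ρ : Observable} {ω r : Fin 4 → ℝ} (hr : IsStateForm ρ r)
    (hr' : CanonicalOrder r) (hω : IsObsForm W ω) (hω' : AntiCanonicalOrder ω)
    (hnn : 0 ≤ ω 0 + ω 1) :
    IsLeast (Set.range fun M : LSL => trPair (obsAct M W) ρ) (∑ μ, r μ * ω μ) := by
  obtain ⟨M, hM⟩ := hr
  obtain ⟨N, hN⟩ := hω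
  rw [range_trPair hN hM]
  refine ⟨⟨1, by simp only [obsAct_one, trPair_bellDiag]⟩, ?_⟩
  rintro _ ⟨K, rfl⟩
  simp only [trPair_obsAct_bellDiag_bellDiag]
  exact sum_mul_le_of_orthogonal (frame_toOp_orthogonal _)
    (signed_sum_normSq_frame_nonneg _ _) hr' hω' hnn

theorem isObsForm_bellDiag (ω : Fin 4 → ℝ) : IsObsForm (bellDiag ω) ω := ⟨1, obsAct_one _⟩

theorem CanonicalOrder.eq_of_isStateForm {ρ : Observable} {r r' : Fin 4 → ℝ}
    (hr : IsStateForm ρ r) (hr' : IsStateForm ρ r') (h : CanonicalOrder r)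
    (h' : CanonicalOrder r') : r = r' := by
  have key : ∀ ω : Fin 4 → ℝ, AntiCanonicalOrder ω → 0 ≤ ω 0 + ω 1 →
      ∑ μ, r μ * ω μ = ∑ μ, r' μ * ω μ := fun ω hω hnn =>
    (isLeast_trPair hr h (isObsForm_bellDiag ω) hω hnn).unique
      (isLeast_trPair hr' h' (isObsForm_bellDiag ω) hω hnn)
  -- These test forms give the tail sums of `r` and `r'`, whose differences are the coefficients.
  have k0 := key ![1, 1, 1, 1] (by simp [AntiCanonicalOrder]) (by simp)
  have k1 := key ![0, 1, 1, 1] (by simp [AntiCanonicalOrder]) (by simp)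
  have k2 := key ![0, 0, 1, 1] (by simp [AntiCanonicalOrder]) (by simp)
  have k3 := key ![0, 0, 0, 1] (by simp [AntiCanonicalOrder]) (by simp)
  simp [Fin.sum_univ_four] at k0 k1 k2 k3
  ext μ
  fin_cases μ <;> simp <;> linarith

theorem AntiCanonicalOrder.eq_of_isObsForm {W : Observable} {ω ω' : Fin 4 → ℝ}
    (hω : IsObsForm W ω) (hω' : IsObsForm W ω') (h : AntiCanonicalOrder ω)
    (h' : AntiCanonicalOrder ω') (hnn : 0 ≤ ω 0 + ω 1) (hnn' : 0 ≤ ω' 0 + ω' 1) : ω = ω' := by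
  have key : ∀ r : Fin 4 → ℝ, CanonicalOrder r → ∑ μ, r μ * ω μ = ∑ μ, r μ * ω' μ := fun r hr =>
    have hr' := isStateForm_iff.2 (isObsForm_bellDiag r)
    (isLeast_trPair hr' hr hω h hnn).unique (isLeast_trPair hr' hr hω' h' hnn')
  -- Dually, these canonical test forms give the initial sums of `ω` and `ω'`.
  have k0 := key ![1, 1, 1, 1] (by simp [CanonicalOrder])
  have k1 := key ![1, 1, 1, 0] (by simp [CanonicalOrder])
  have k2 := key ![1, 1, 0, 0] (by simp [CanonicalOrder])
  have k3 := key ![1, 0, 0, 0] (by simp [CanonicalOrder])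
  simp [Fin.sum_univ_four] at k0 k1 k2 k3
  ext μ
  fin_cases μ <;> simp <;> linarith

theorem tr_eq_trPair (W : Observable) : tr W = trPair W (bellDiag fun _ => 1) := by
  have h : (bellDiag fun _ => 1 : Op2) = 1 :=
    frame_injective (by rw [frame_bellDiag, frame_one]; simp)
  rw [tr, trPair, h, Matrix.mul_one]

theorem isLeast_tr {W : Observable} (hW : W ∈ potentialWitnesses) {ω : Fin 4 → ℝ}
    (hω : IsObsForm W ω) :
    IsLeast (Set.range fun M : LSL => tr (obsAct M W)) (tr (bellDiag ω)) := by
  have hnn := fun i j (hij : i ≠ j) => add_nonneg_of_isObsForm hW hω hij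
  obtain ⟨N, hN⟩ := hω
  refine ⟨⟨N, by simp only [hN]⟩, ?_⟩
  rintro _ ⟨K, rfl⟩
  have hK : obsAct K W = obsAct (N⁻¹ * K) (bellDiag ω) := by
    rw [← hN, obsAct_obsAct, mul_inv_cancel_left]
  simp only [hK, tr_eq_trPair, trPair_obsAct_bellDiag_bellDiag, trPair_bellDiag, one_mul]
  exact sum_le_of_orthogonal (frame_toOp_orthogonal _) hnn

end TwoQubit

theorem mainTheorem2 (W ρ : TwoQubit.Observable)
    (hW : W ∈ interior TwoQubit.potentialWitnesses)
    (hρ : ρ ∈ interior TwoQubit.potentialWitnesses) :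
    (∃! r : Fin 4 → ℝ, TwoQubit.IsStateForm ρ r ∧ TwoQubit.CanonicalOrder r) ∧
    (∃! ω : Fin 4 → ℝ, TwoQubit.IsObsForm W ω ∧ TwoQubit.AntiCanonicalOrder ω) ∧
    (∀ r ω : Fin 4 → ℝ,
      TwoQubit.IsStateForm ρ r → TwoQubit.CanonicalOrder r →
      TwoQubit.IsObsForm W ω → TwoQubit.AntiCanonicalOrder ω →
      IsLeast (Set.range fun M : TwoQubit.LSL => TwoQubit.trPair (TwoQubit.obsAct M W) ρ)
        (TwoQubit.trPair (TwoQubit.bellDiag ω) (TwoQubit.bellDiag r)) ∧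
      TwoQubit.trPair (TwoQubit.bellDiag ω) (TwoQubit.bellDiag r) = ∑ μ, r μ * ω μ) ∧
    (∀ ω : Fin 4 → ℝ, TwoQubit.IsObsForm W ω →
      IsLeast (Set.range fun M : TwoQubit.LSL => TwoQubit.tr (TwoQubit.obsAct M W))
        (TwoQubit.tr (TwoQubit.bellDiag ω)) ∧
      TwoQubit.tr (TwoQubit.bellDiag ω) ≤ TwoQubit.tr W) := by
  have hW' := interior_subset hW
  have hnn : ∀ {ω : Fin 4 → ℝ}, TwoQubit.IsObsForm W ω → 0 ≤ ω 0 + ω 1 := fun h =>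
    TwoQubit.add_nonneg_of_isObsForm hW' h (by decide)
  refine ⟨?_, ?_, fun r ω hr hr' hω hω' => ?_, fun ω hω => ?_⟩
  -- Reversing the order makes `r` decreasing; the bound `-r 2 ≤ r 3` needed for `|r 3|` is the
  -- witness condition on the pair `2, 3`.
  · obtain ⟨r, hr, hord⟩ := TwoQubit.exists_isObsForm hρ Fin.revPerm
    have h01 := hord 2 3 (by decide)
    have h12 := hord 1 2 (by decide)
    have h23 := hord 0 1 (by decide)
    have hsum := TwoQubit.add_nonneg_of_isObsForm (interior_subset hρ) hr
      (i := 2) (j := 3) (by decide)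
    have hcan : TwoQubit.CanonicalOrder r :=
      ⟨h01, h12, abs_le.2 ⟨by linarith, h23⟩⟩
    have hst := TwoQubit.isStateForm_iff.2 hr
    exact ⟨r, ⟨hst, hcan⟩, fun r' h => h.2.eq_of_isStateForm h.1 hst hcan⟩
  · obtain ⟨ω, hω, hord⟩ := TwoQubit.exists_isObsForm hW 1
    have hanti : TwoQubit.AntiCanonicalOrder ω :=
      ⟨hord 0 1 (by decide), hord 1 2 (by decide), hord 2 3 (by decide)⟩
    exact ⟨ω, ⟨hω, hanti⟩, fun ω' h => h.2.eq_of_isObsForm h.1 hω hanti (hnn h.1) (hnn hω)⟩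
  · rw [TwoQubit.trPair_bellDiag]
    exact ⟨TwoQubit.isLeast_trPair hr hr' hω hω' (hnn hω), rfl⟩
  · have h := TwoQubit.isLeast_tr hW' hω
    exact ⟨h, h.2 ⟨1, by simp only [TwoQubit.obsAct_one]⟩⟩
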